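/- For $r\ge 0$, positive integers $k_1,\dots,k_r$ and $n\ge 0$ let $$t_n(k_1,\dots,k_r)=\sum_{n\ge n_1>\cdots>n_r>0}\prod_{j=1}^r\frac1{(2n_j-1)^{k_j}},\qquad t^\star_n(k_1,\dots,k_r)=\sum_{n\ge n_1\ge\cdots\ge n_r>0}\prod_{j=1}^r\frac1{(2n_j-1)^{k_j}},$$ with $t_n(\emptyset)=t_n^\star(\emptyset)=1$, and let $1_d$ denote $1$ repeated $d$ times. For signs $\varepsilon_j=\pm1$ and roots of unity $z_j$ put $$t(k_1,\dots,k_r;\varepsilon_1,\dots,\varepsilon_r)=\lim_{n\to\infty}\sum_{n\ge n_1>\cdots>n_r>0}\prod_{j=1}^r\frac{\varepsilon_j^{n_j}}{(2n_j-1)^{k_j}},\qquad \mathrm{Li}_{k_1,\dots,k_r}(z_1,\dots,z_r)=\lim_{n\to\infty}\sum_{n\ge n_1>\cdots>n_r>0}\prod_{j=1}^r\frac{z_j^{n_j}}{n_j^{k_j}},$$ where $(k_1,\varepsilon_1)\ne(1,1)$, respectively $(k_1,z_1)\neq(1,1)$; the weight of these values is $k_1+\cdots+k_r$. Let $\mathrm{AMtV}_w\subset\mathbb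 R$ be the $\mathbb Q$-span of all the $t(\mathbf k;\boldsymbol\varepsilon)$ of weight $w$ in which at least one $\varepsilon_j$ is $-1$, and let $\mathrm{CMZV}^4_w\subset\mathbb C$ be the $\mathbb Q$-span of all the $\mathrm{Li}_{\mathbf k}(\mathbf z)$ of weight $w$ with $z_j^4=1$ for all $j$. Then for every integer $m\ge 0$ all series below converge and $$\sum_{n=0}^\infty\left[\frac1{4^n}\binom{2n}{n}\right]^2\frac1{(2n+1)^{m+1}}=\frac4\pi\sum_{k=0}^m\sum_{n=0}^\infty(-1)^n\frac{t_n(1_k)\,t^\star_{n+1}(1_{m-k})}{(2n+1)^2}=-\frac2\pi\sum_{d=1}^{m+1}\ \sum_{\substack{\mathbf s=(s_1,\dots,s_d)\in\mathbb Z_{>0}^d\\ s_1+\cdots+s_d=m+2,\ s_1\ge2}}2^d\,t(\mathbf s;-1,1_{d-1}).$$ This number lies in $\frac1\pi\mathrm{AMtV}_{m+2}$, and $$\mathrm{AMtV}_{m+2}\subset \mathrm{CMZV}^4_{m+2}+i\,\mathrm{CMZV}^4_{m+2}$$ (the $\mathbb Q(i)$-span of the colored multiple zeta values of level $4$ and weight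 $m+2$). More precisely, the number lies in $\frac i\pi\,\mathrm{CMZV}^4_{m+2}$. -/

import Mathlib

noncomputable section

namespace AperyMtV

/-- The multiple `t`-harmonic sum
`t_n(k₁,…,k_r) = ∑_{n ≥ n₁ > ⋯ > n_r > 0} ∏ 1/(2n_j-1)^{k_j}`, with `t_n(∅) = 1`. -/
def tSum : List ℕ → ℕ → ℝ
  | [], _ => 1
  | k :: ks, n => ∑ j ∈ Finset.Icc 1 n, 1 / (2 * (j : ℝ) - 1) ^ k * tSum ks (j - 1)

/-- The multiple `t`-harmonic star sum
`t⋆_n(k₁,…,k_r) = ∑_{n ≥ n₁ ≥ ⋯ ≥ n_r > 0} ∏ 1/(2n_j-1)^{k_j}`, with `t⋆_n(∅) = 1`. -/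
def tStarSum : List ℕ → ℕ → ℝ
  | [], _ => 1
  | k :: ks, n => ∑ j ∈ Finset.Icc 1 n, 1 / (2 * (j : ℝ) - 1) ^ k * tStarSum ks j

/-- The truncated multiple `t`-sum with signs, for the list `(k₁,ε₁),…,(k_r,ε_r)`:
`∑_{n ≥ n₁ > ⋯ > n_r > 0} ∏ ε_j^{n_j}/(2n_j-1)^{k_j}`. -/
def signedTSum : List (ℕ × ℝ) → ℕ → ℝ
  | [], _ => 1
  | (k, ε) :: l, n =>
      ∑ j ∈ Finset.Icc 1 n, ε ^ j / (2 * (j : ℝ) - 1) ^ k * signedTSum l (j - 1)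

/-- The multiple `t`-value `t(k₁,…,k_r; ε₁,…,ε_r)`, the limit of the truncated sums. -/
def mtv (l : List (ℕ × ℝ)) : ℝ := Filter.limUnder Filter.atTop (signedTSum l)

/-- The truncated colored multiple sum for the list `(k₁,z₁),…,(k_r,z_r)`:
`∑_{n ≥ n₁ > ⋯ > n_r > 0} ∏ z_j^{n_j}/n_j^{k_j}`. -/
def coloredSum : List (ℕ × ℂ) → ℕ → ℂ
  | [], _ => 1
  | (k, z) :: l, n =>
      ∑ j ∈ Finset.Icc 1 n, z ^ j / (j : ℂ) ^ k * coloredSum l (j - 1)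

/-- The colored multiple zeta value `Li_{k₁,…,k_r}(z₁,…,z_r)`, the limit of the
truncated sums. -/
def cmzv (l : List (ℕ × ℂ)) : ℂ := Filter.limUnder Filter.atTop (coloredSum l)

/-- The weight `k₁ + ⋯ + k_r`. -/
def weight {α : Type} (l : List (ℕ × α)) : ℕ := (l.map Prod.fst).sum

/-- `k₁,…,k_r` are positive integers and `(k₁,z₁) ≠ (1,1)`. -/
def Admissible {α : Type} [One α] (l : List (ℕ × α)) : Prop :=
  (∀ p ∈ l, 1 ≤ p.1) ∧ ∀ p ∈ l.head?, p ≠ (1, 1)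

/-- The `ℚ`-span of all alternating multiple `t`-values of weight `w`: the (convergent) multiple
`t`-values `t(k; ε)` with signs `ε_j = ±1`, at least one of which is `-1`. -/
def AMtV (w : ℕ) : Submodule ℚ ℝ :=
  Submodule.span ℚ {x | ∃ l : List (ℕ × ℝ), Admissible l ∧ weight l = w ∧
    (∀ p ∈ l, p.2 = 1 ∨ p.2 = -1) ∧ (∃ p ∈ l, p.2 = -1) ∧ x = mtv l}

/-- The `ℚ`-span of all colored multiple zeta values of level `N` and weight `w`. -/
def CMZV (N w : ℕ) : Submodule ℚ ℂ :=
  Submodule.span ℚ {x | ∃ l : List (ℕ × ℂ), Admissible l ∧ weight l = w ∧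
    (∀ p ∈ l, p.2 ^ N = 1) ∧ x = cmzv l}

/-- The Apéry-type series `∑_{n ≥ 0} [binom(2n,n)/4^n]^2 / (2n+1)^(m+1)`: its `n`-th term. -/
def aperyTerm (m n : ℕ) : ℝ :=
  ((Nat.choose (2 * n) n : ℝ) / 4 ^ n) ^ 2 / (2 * (n : ℝ) + 1) ^ (m + 1)

/-- The `n`-th term `(-1)^n t_n(1_k) t⋆_{n+1}(1_l) / (2n+1)^2`. -/
def tProductTerm (k l n : ℕ) : ℝ :=
  (-1) ^ n * (tSum (List.replicate k 1) n * tStarSum (List.replicate l 1) (n + 1)) /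
    (2 * (n : ℝ) + 1) ^ 2

/-- The decorated index `(s; -1, 1, …, 1)` of a composition `s`. -/
def firstBarred {w : ℕ} (s : Composition w) : List (ℕ × ℝ) :=
  s.blocks.zip (-1 :: List.replicate (s.length - 1) 1)

/-- The compositions `s = (s₁,…,s_d)` of `w` of depth `d` with `s₁ ≥ 2`. -/
def compositionsOfDepth (w d : ℕ) : Finset (Composition w) :=
  {s | s.length = d ∧ 2 ≤ s.blocks.headI}

end AperyMtV

end

/-!
With `a_k = [binom(2k,k)/4^k]^2`, the complete elliptic integral is `K(√u) = π/2 ∑ a_k u^k`, and its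
expansion in shifted Legendre polynomials is `K(√u) = ∑ 2/(2n+1) P_n(2u-1)`. The first evaluation
is the Mellin transform of this expansion against `u^{-(1+x)/2}`, read off coefficientwise in `x`:
the left side becomes `∑ a_k/(2k+1-x)`, and the Mellin transform of `P_n(2u-1)` is, up to a factor `±2`,
`1/(2n+1-x) ∏_{j ≤ n} (2j-1+x)/(2j-1-x)`, whose coefficients are the products
`∑ t_n(1_k) t⋆_{n+1}(1_{m-k})`.

No analysis of `K` is needed. Put `q(k,n) = ∫₀¹ u^k P_n(2u-1) du` (`legendreMoment`). Expanding
the monomial `u^k` is the finite identity `∑_{n ≤ k} (-1)^n q(k,n) H(m,n) = 1/(2k+1)^{m+1}`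
(`sum_legendreMoment_mul_tProduct`, with `H = tProduct`), a sum of power series that telescopes
in `n`. The Legendre coefficients of `2K/π` are `∑_k a_k q(k,n) = (4/π)/(2n+1)^2`
(`hasSum_centralSq_mul_legendreMoment`), by induction on `n` with a sum that telescopes in `k`,
starting from Wallis' product. Since `q ≥ 0` and nested harmonic sums grow like powers of a
logarithm, the double sum `∑ a_k (-1)^n q(k,n) H(m,n)` converges absolutely, and summing it in the
two orders gives the first evaluation (`hasSum_aperyTerm`).

The second evaluation expands `∏_{j ≤ n} (2j-1+x)/(2j-1-x) = ∏_{j ≤ n} (1 + 2 ∑_s x^s/(2j-1)^s)` over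
compositions, term by term in `n` (`compositionSeries_eq`, `sum_composition_tSum`).

For the level four statements, the substitution `N = 2n-1` detects odd `N` and the sign `(-1)^n` by
the fourth roots of unity `(1^N - (-1)^N)/2` and `i (i^N - (-i)^N)/2`. Thus a signed `t`-sum with `r`
signs `-1` is `i^r` times a rational combination of colored sums (`exists_mem_liftSpan`); for the
indices `(s; -1, 1, …, 1)` this factor is `i`. The admissibility condition is preserved, and
truncated colored sums converge under it, conditionally (by Abel summation) when the leading
exponent is `1` (`tendsto_coloredSum`).
-/

noncomputable section

namespace AperyMtV

open Filter Topology

/-! ### Shifted Legendre coefficients of monomials -/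

/-- The moment `∫₀¹ uᵏ Pₙ(2u - 1) du = k!² / ((k - n)! (k + n + 1)!)` of the `n`-th shifted Legendre
polynomial, as a rational function of `k`; it vanishes for `k < n`. -/
def legendreMoment (k : ℕ) : ℕ → ℝ
  | 0 => 1 / (k + 1)
  | n + 1 => legendreMoment k n * ((k - n) / (k + n + 2))

lemma legendreMoment_succ_mul (k n : ℕ) :
    legendreMoment k (n + 1) * (k + n + 2) = legendreMoment k n * (k - n) := by
  have : (k + n + 2 : ℝ) ≠ 0 := by positivity
  rw [legendreMoment]
  field_simp

lemma legendreMoment_eq_zero {k n : ℕ} (h : k < n) : legendreMoment k n = 0 := by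
  induction n, h using Nat.le_induction with
  | base => simp [legendreMoment]
  | succ n _ ih => simp [legendreMoment, ih]

lemma legendreMoment_nonneg (k n : ℕ) : 0 ≤ legendreMoment k n := by
  induction n with
  | zero => rw [legendreMoment]; positivity
  | succ n ih =>
    rcases le_or_gt n k with h | h
    · have : (n : ℝ) ≤ k := by exact_mod_cast h
      exact mul_nonneg ih (div_nonneg (sub_nonneg.2 this) (by positivity))
    · rw [legendreMoment_eq_zero (by omega)]

lemma legendreMoment_le (k n : ℕ) : legendreMoment k n ≤ 1 / (k + 1) := by
  induction n with
  | zero => rw [legendreMoment]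
  | succ n ih =>
    refine le_trans (mul_le_of_le_one_right (legendreMoment_nonneg k n) ?_) ih
    rw [div_le_one (by positivity)]
    have : (0 : ℝ) ≤ n := n.cast_nonneg
    linarith

/-- The recurrence `q(k+1,n) = q(k,n) (k+1)² / ((k+1-n)(k+n+2))`, cleared of denominators because
`k + 1 - n` may vanish. -/
lemma legendreMoment_succ_left (k n : ℕ) :
    (k + 1 - n) * (k + n + 2) * legendreMoment (k + 1) n = (k + 1) ^ 2 * legendreMoment k n := by
  induction n with
  | zero =>
    simp only [legendreMoment]
    push_cast
    field_simp
    ring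
  | succ n ih =>
    have h1 := legendreMoment_succ_mul (k + 1) n
    have h2 := legendreMoment_succ_mul k n
    have h3 : (k + n + 2 : ℝ) ≠ 0 := by positivity
    apply mul_right_cancel₀ h3
    push_cast at *
    linear_combination (k + 1 - (n + 1)) * (k + n + 2) * h1 + (k - n) * ih - (k + 1) ^ 2 * h2

/-! ### Squared central binomial coefficients -/

/-- The squared normalised central binomial coefficient `[binom(2k,k)/4^k]^2`. -/
def centralSq (k : ℕ) : ℝ := ((Nat.choose (2 * k) k : ℝ) / 4 ^ k) ^ 2

lemma centralSq_nonneg (k : ℕ) : 0 ≤ centralSq k := sq_nonneg _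

lemma centralSq_succ (k : ℕ) :
    centralSq (k + 1) * (k + 1) ^ 2 = centralSq k * (k + 1 / 2) ^ 2 := by
  have h := Nat.succ_mul_centralBinom_succ k
  simp only [Nat.centralBinom] at h
  have h' : ((k : ℝ) + 1) * (Nat.choose (2 * (k + 1)) (k + 1) : ℝ)
      = 2 * (2 * k + 1) * (Nat.choose (2 * k) k : ℝ) := by exact_mod_cast h
  have : centralSq (k + 1) * (k + 1) ^ 2
      = (((k : ℝ) + 1) * (Nat.choose (2 * (k + 1)) (k + 1) : ℝ) / 4 ^ (k + 1)) ^ 2 := by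
    rw [centralSq]; ring
  rw [this, h', centralSq]
  ring

lemma centralSq_mul_wallis (k : ℕ) : centralSq k * (2 * k + 1) * Real.Wallis.W k = 1 := by
  induction k with
  | zero => simp [centralSq, Real.Wallis.W]
  | succ k ih =>
    have h := centralSq_succ k
    have hW : Real.Wallis.W (k + 1) * ((2 * k + 1) * (2 * k + 3))
        = Real.Wallis.W k * (2 * k + 2) ^ 2 := by
      simp only [Real.Wallis.W, Finset.prod_range_succ]
      field_simp
    have h1 : ((k : ℝ) + 1) ^ 2 * ((2 * k + 1) * (2 * k + 3)) ≠ 0 := by positivity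
    apply mul_right_cancel₀ h1
    push_cast
    calc centralSq (k + 1) * (2 * (k + 1) + 1) * Real.Wallis.W (k + 1)
          * ((k + 1) ^ 2 * ((2 * k + 1) * (2 * k + 3)))
        = (centralSq (k + 1) * (k + 1) ^ 2) * (2 * k + 3)
          * (Real.Wallis.W (k + 1) * ((2 * k + 1) * (2 * k + 3))) := by ring
      _ = (centralSq k * (2 * k + 1) * Real.Wallis.W k)
          * ((k + 1) ^ 2 * ((2 * k + 1) * (2 * k + 3))) := by rw [h, hW]; ring
      _ = _ := by rw [ih]

/-- Wallis' product: `[binom(2k,k)/4^k]^2 ~ 1/(πk)`. -/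
lemma tendsto_centralSq_mul : Tendsto (fun k : ℕ => centralSq k * (2 * k + 1)) atTop
    (𝓝 (2 / Real.pi)) := by
  have h := Real.Wallis.tendsto_W_nhds_pi_div_two.inv₀ (by positivity)
  rw [inv_div] at h
  exact h.congr fun k => (eq_inv_of_mul_eq_one_left (centralSq_mul_wallis k)).symm

lemma tendsto_centralSq : Tendsto centralSq atTop (𝓝 0) := by
  have h1 : Tendsto (fun k : ℕ => (2 * (k : ℝ) + 1)) atTop atTop :=
    tendsto_atTop_add_const_right _ _ (tendsto_natCast_atTop_atTop.const_mul_atTop two_pos)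
  refine (tendsto_centralSq_mul.div_atTop h1).congr fun k => ?_
  have : (2 * (k : ℝ) + 1) ≠ 0 := by positivity
  field_simp

/-- The integrals of `P_n(2u-1)` against `∑ centralSq k uᵏ = 2/π K(√u)`.
In `n` the recurrence `(2n+3)² s_{n+1} = (2n+1)² s_n` follows from a certificate telescoping
in `k`; the case `n = 0` is Wallis' product. -/
lemma hasSum_centralSq_mul_legendreMoment (n : ℕ) :
    HasSum (fun k => centralSq k * legendreMoment k n)
      (4 / Real.pi * (1 / (2 * (n : ℝ) + 1) ^ 2)) := by
  rw [hasSum_iff_tendsto_nat_of_nonneg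
    (fun k => mul_nonneg (centralSq_nonneg k) (legendreMoment_nonneg k n))]
  induction n with
  | zero =>
    -- The terms are the increments of `4 K * centralSq K`, written so that Wallis applies.
    have hsum : ∀ K : ℕ, ∑ k ∈ Finset.range K, centralSq k * legendreMoment k 0
        = 2 * (centralSq K * (2 * K + 1)) - 2 * centralSq K := by
      intro K
      induction K with
      | zero => simp
      | succ K ih =>
        rw [Finset.sum_range_succ, ih, legendreMoment]
        have h := centralSq_succ K
        have h1 : (K + 1 : ℝ) ≠ 0 := by positivity
        push_cast
        field_simp
        linear_combination (-4) * h
    simp only [hsum]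
    have := (tendsto_centralSq_mul.const_mul 2).sub (tendsto_centralSq.const_mul 2)
    convert this using 2
    simp
    ring
  | succ n ih =>
    have h0 : (n : ℝ) * legendreMoment 0 n = 0 := by
      rcases Nat.eq_zero_or_pos n with rfl | h
      · simp
      · rw [legendreMoment_eq_zero h, mul_zero]
    -- The certificate is `-8 (n+1) (K-n) centralSq K * legendreMoment K n`.
    have hsum : ∀ K : ℕ, ∑ k ∈ Finset.range K, centralSq k * legendreMoment k (n + 1)
        = ((2 * n + 1) ^ 2 * ∑ k ∈ Finset.range K, centralSq k * legendreMoment k n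
          - 8 * (n + 1) * (centralSq K * ((K - n) * legendreMoment K n))) / (2 * n + 3) ^ 2 := by
      intro K
      induction K with
      | zero =>
        simp [centralSq, h0]
      | succ K ih =>
        rw [Finset.sum_range_succ, ih, Finset.sum_range_succ, legendreMoment]
        have h := centralSq_succ K
        have h4 := legendreMoment_succ_left K n
        have h1 : (K + n + 2 : ℝ) ≠ 0 := by positivity
        have h3 : centralSq (K + 1) * ((K + 1 - n) * legendreMoment (K + 1) n)
            = centralSq K * (K + 1 / 2) ^ 2 * legendreMoment K n / (K + n + 2) := by
          rw [eq_div_iff h1]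
          linear_combination centralSq (K + 1) * h4 + legendreMoment K n * h
        push_cast
        rw [h3]
        field_simp
        ring
    have hbd : Tendsto (fun K : ℕ => centralSq K * ((K - n) * legendreMoment K n)) atTop (𝓝 0) := by
      refine squeeze_zero' ?_ ?_ tendsto_centralSq
      · filter_upwards [eventually_ge_atTop n] with K hK
        have : (n : ℝ) ≤ K := by exact_mod_cast hK
        exact mul_nonneg (centralSq_nonneg K)
          (mul_nonneg (sub_nonneg.2 this) (legendreMoment_nonneg K n))
      · filter_upwards [eventually_ge_atTop n] with K hK
        have h2 : (n : ℝ) ≤ K := by exact_mod_cast hK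
        refine mul_le_of_le_one_right (centralSq_nonneg K) ?_
        calc (K - n : ℝ) * legendreMoment K n ≤ (K + 1) * (1 / (K + 1)) := by
              refine mul_le_mul ?_ (legendreMoment_le K n) (legendreMoment_nonneg K n)
                (by positivity)
              have : (0 : ℝ) ≤ n := n.cast_nonneg
              linarith
          _ = 1 := by field_simp
    simp only [hsum]
    have := ((ih.const_mul ((2 * (n : ℝ) + 1) ^ 2)).sub
      (hbd.const_mul (8 * ((n : ℝ) + 1)))).div_const ((2 * (n : ℝ) + 3) ^ 2)
    convert this using 2
    push_cast
    have : Real.pi ≠ 0 := Real.pi_ne_zero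
    field_simp
    ring

/-! ### Recurrences and growth of the nested sums -/

lemma tSum_cons_zero (a : ℕ) (l : List ℕ) : tSum (a :: l) 0 = 0 := by
  simp [tSum]

lemma tSum_cons_succ (a : ℕ) (l : List ℕ) (n : ℕ) :
    tSum (a :: l) (n + 1) = tSum (a :: l) n + 1 / (2 * (n : ℝ) + 1) ^ a * tSum l n := by
  rw [tSum, Finset.sum_Icc_succ_top (by omega), tSum]
  push_cast
  rw [show 2 * ((n : ℝ) + 1) - 1 = 2 * n + 1 by ring]

lemma tStarSum_cons_zero (a : ℕ) (l : List ℕ) : tStarSum (a :: l) 0 = 0 := by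
  simp [tStarSum]

lemma tStarSum_cons_succ (a : ℕ) (l : List ℕ) (n : ℕ) :
    tStarSum (a :: l) (n + 1)
      = tStarSum (a :: l) n + 1 / (2 * (n : ℝ) + 1) ^ a * tStarSum l (n + 1) := by
  rw [tStarSum, Finset.sum_Icc_succ_top (by omega), tStarSum]
  push_cast
  rw [show 2 * ((n : ℝ) + 1) - 1 = 2 * n + 1 by ring]

lemma coloredSum_cons_zero (p : ℕ × ℂ) (l : List (ℕ × ℂ)) : coloredSum (p :: l) 0 = 0 := by
  simp [coloredSum]

lemma coloredSum_cons_succ (k : ℕ) (z : ℂ) (l : List (ℕ × ℂ)) (n : ℕ) :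
    coloredSum ((k, z) :: l) (n + 1)
      = coloredSum ((k, z) :: l) n + z ^ (n + 1) / ((n + 1 : ℕ) : ℂ) ^ k * coloredSum l n := by
  rw [coloredSum, Finset.sum_Icc_succ_top (by omega), coloredSum, Nat.add_sub_cancel]

lemma signedTSum_cons_zero (p : ℕ × ℝ) (l : List (ℕ × ℝ)) : signedTSum (p :: l) 0 = 0 := by
  simp [signedTSum]

lemma signedTSum_cons_succ (k : ℕ) (ε : ℝ) (l : List (ℕ × ℝ)) (n : ℕ) :
    signedTSum ((k, ε) :: l) (n + 1)
      = signedTSum ((k, ε) :: l) n + ε ^ (n + 1) / (2 * (n : ℝ) + 1) ^ k * signedTSum l n := by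
  rw [signedTSum, Finset.sum_Icc_succ_top (by omega), signedTSum, Nat.add_sub_cancel]
  push_cast
  rw [show 2 * ((n : ℝ) + 1) - 1 = 2 * n + 1 by ring]

/-- Forgetting signs that are all `1`. -/
lemma signedTSum_zip_replicate_one (l : List ℕ) :
    signedTSum (l.zip (List.replicate l.length 1)) = tSum l := by
  induction l with
  | nil => funext n; simp [signedTSum, tSum]
  | cons a l ih =>
    funext n
    simp only [List.length_cons, List.replicate_succ, List.zip_cons_cons, signedTSum, tSum, ih,
      one_pow]

/-- The harmonic numbers as real numbers. -/
abbrev harm (n : ℕ) : ℝ := ((harmonic n : ℚ) : ℝ)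

lemma harm_succ (n : ℕ) : harm (n + 1) = harm n + 1 / ((n : ℝ) + 1) := by
  simp [harm, harmonic_succ]

lemma harm_nonneg (n : ℕ) : 0 ≤ harm n := by
  induction n with
  | zero => simp [harm]
  | succ n ih => rw [harm_succ]; positivity

lemma harm_mono : Monotone harm := monotone_nat_of_le_succ fun n => by
  rw [harm_succ]
  exact le_add_of_nonneg_right (by positivity)

lemma harm_pow_step (r n : ℕ) :
    harm n ^ (r + 1) + 1 / ((n : ℝ) + 1) * harm (n + 1) ^ r ≤ harm (n + 1) ^ (r + 1) := by
  have h1 : harm n ^ r ≤ harm (n + 1) ^ r :=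
    pow_le_pow_left₀ (harm_nonneg n) (harm_mono n.le_succ) r
  have h2 := mul_le_mul_of_nonneg_left h1 (harm_nonneg n)
  calc harm n ^ (r + 1) + 1 / ((n : ℝ) + 1) * harm (n + 1) ^ r
      = harm n * harm n ^ r + 1 / ((n : ℝ) + 1) * harm (n + 1) ^ r := by ring
    _ ≤ harm n * harm (n + 1) ^ r + 1 / ((n : ℝ) + 1) * harm (n + 1) ^ r := by gcongr
    _ = (harm n + 1 / ((n : ℝ) + 1)) * harm (n + 1) ^ r := by ring
    _ = harm (n + 1) ^ (r + 1) := by rw [← harm_succ]; ring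

lemma harm_pow_step' (r n : ℕ) :
    harm n ^ (r + 1) + 1 / ((n : ℝ) + 1) * harm n ^ r ≤ harm (n + 1) ^ (r + 1) :=
  le_trans (by
    gcongr
    · exact harm_nonneg n
    · exact harm_mono n.le_succ) (harm_pow_step r n)

lemma one_div_odd_pow_le {a : ℕ} (ha : 1 ≤ a) (n : ℕ) :
    1 / (2 * (n : ℝ) + 1) ^ a ≤ 1 / ((n : ℝ) + 1) := by
  have h0 : (0 : ℝ) ≤ n := n.cast_nonneg
  apply one_div_le_one_div_of_le (by positivity)
  calc (n : ℝ) + 1 ≤ 2 * n + 1 := by linarith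
    _ ≤ (2 * (n : ℝ) + 1) ^ a := le_self_pow₀ (by linarith) (by omega)

lemma tSum_nonneg (l : List ℕ) (n : ℕ) : 0 ≤ tSum l n := by
  induction l generalizing n with
  | nil => simp [tSum]
  | cons a l ih =>
    induction n with
    | zero => rw [tSum_cons_zero]
    | succ n ihn =>
      rw [tSum_cons_succ]
      have := ih n
      positivity

lemma tStarSum_nonneg (l : List ℕ) (n : ℕ) : 0 ≤ tStarSum l n := by
  induction l generalizing n with
  | nil => simp [tStarSum]
  | cons a l ih =>
    induction n with
    | zero => rw [tStarSum_cons_zero]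
    | succ n ihn =>
      rw [tStarSum_cons_succ]
      have := ih (n + 1)
      positivity

lemma tSum_le_harm_pow {l : List ℕ} (hl : ∀ a ∈ l, 1 ≤ a) (n : ℕ) :
    tSum l n ≤ harm n ^ l.length := by
  induction l generalizing n with
  | nil => simp [tSum]
  | cons a l ih =>
    simp only [List.mem_cons, forall_eq_or_imp] at hl
    induction n with
    | zero => rw [tSum_cons_zero]; exact pow_nonneg (harm_nonneg 0) _
    | succ n ihn =>
      rw [tSum_cons_succ]
      refine le_trans (add_le_add ihn (mul_le_mul (one_div_odd_pow_le hl.1 n) (ih hl.2 n)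
        (tSum_nonneg l n) (by positivity))) (harm_pow_step' _ n)

lemma tStarSum_le_harm_pow {l : List ℕ} (hl : ∀ a ∈ l, 1 ≤ a) (n : ℕ) :
    tStarSum l n ≤ harm n ^ l.length := by
  induction l generalizing n with
  | nil => simp [tStarSum]
  | cons a l ih =>
    simp only [List.mem_cons, forall_eq_or_imp] at hl
    induction n with
    | zero => rw [tStarSum_cons_zero]; exact pow_nonneg (harm_nonneg 0) _
    | succ n ihn =>
      rw [tStarSum_cons_succ]
      refine le_trans (add_le_add ihn (mul_le_mul (one_div_odd_pow_le hl.1 n) (ih hl.2 (n + 1))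
        (tStarSum_nonneg l (n + 1)) (by positivity))) (harm_pow_step _ n)

lemma norm_coloredSum_le_harm_pow {l : List (ℕ × ℂ)} (hl : ∀ p ∈ l, 1 ≤ p.1 ∧ ‖p.2‖ ≤ 1) (n : ℕ) :
    ‖coloredSum l n‖ ≤ harm n ^ l.length := by
  induction l generalizing n with
  | nil => simp [coloredSum]
  | cons p l ih =>
    obtain ⟨k, z⟩ := p
    simp only [List.mem_cons, forall_eq_or_imp] at hl
    induction n with
    | zero => rw [coloredSum_cons_zero, norm_zero]; exact pow_nonneg (harm_nonneg 0) _
    | succ n ihn =>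
      rw [coloredSum_cons_succ]
      have hz : ‖z ^ (n + 1) / ((n + 1 : ℕ) : ℂ) ^ k‖ ≤ 1 / ((n : ℝ) + 1) := by
        rw [norm_div, norm_pow, norm_pow, Complex.norm_natCast]
        push_cast
        have h1 : (1 : ℝ) ≤ n + 1 := by linarith [n.cast_nonneg (α := ℝ)]
        gcongr
        · exact pow_le_one₀ (norm_nonneg _) hl.1.2
        · exact le_self_pow₀ h1 (by have := hl.1.1; omega)
      refine (norm_add_le _ _).trans ((add_le_add ihn ?_).trans (harm_pow_step' _ n))
      rw [norm_mul]
      exact mul_le_mul hz (ih hl.2 n) (norm_nonneg _) (by positivity)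

lemma harm_pow_isBigO (r : ℕ) :
    (fun n : ℕ => harm (n + 1) ^ r) =O[atTop] fun n : ℕ => ((n : ℝ) + 1) ^ (1 / 2 : ℝ) := by
  have hone : ∀ {s : ℝ}, 0 ≤ s → (fun _ : ℝ => (1 : ℝ)) =O[atTop] fun x => x ^ s := by
    intro s hs
    refine Asymptotics.IsBigO.of_bound 1 ?_
    filter_upwards [eventually_ge_atTop 1] with x hx
    rw [one_mul, norm_one, Real.norm_of_nonneg (by positivity)]
    exact Real.one_le_rpow hx hs
  have hlog : (fun x : ℝ => (1 + Real.log x) ^ r) =O[atTop] fun x => x ^ (1 / 2 : ℝ) := by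
    rcases Nat.eq_zero_or_pos r with rfl | hr
    · simpa only [pow_zero] using hone (by norm_num)
    have h0 : (0 : ℝ) < 1 / (2 * r) := by positivity
    refine (((hone h0.le).add (isLittleO_log_rpow_atTop h0).isBigO).pow r).congr'
      EventuallyEq.rfl ?_
    filter_upwards [eventually_ge_atTop 0] with x hx
    rw [← Real.rpow_natCast, ← Real.rpow_mul hx]
    congr 1
    field_simp
  have hcast : Tendsto (fun n : ℕ => (n : ℝ) + 1) atTop atTop :=
    tendsto_atTop_add_const_right _ _ tendsto_natCast_atTop_atTop
  refine (Asymptotics.IsBigO.of_norm_le fun n => ?_).trans (hlog.comp_tendsto hcast)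
  have h3 := harmonic_le_one_add_log (n + 1)
  have h4 := harm_nonneg (n + 1)
  rw [Real.norm_of_nonneg (by positivity)]
  push_cast at h3
  exact pow_le_pow_left₀ h4 h3 r

/-- `∑ Hₙ₊₁ʳ / (n+1)²` converges; every absolute convergence below is by comparison with it. -/
lemma summable_harm_pow_div_sq (r : ℕ) :
    Summable fun n : ℕ => harm (n + 1) ^ r / ((n : ℝ) + 1) ^ 2 := by
  have hs : Summable fun n : ℕ => (((n + 1 : ℕ) : ℝ) ^ (3 / 2 : ℝ))⁻¹ :=
    (summable_nat_add_iff 1).2 (Real.summable_nat_rpow_inv.2 (by norm_num))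
  refine summable_of_isBigO_nat hs ?_
  simp only [div_eq_mul_inv]
  refine ((harm_pow_isBigO r).mul (Asymptotics.isBigO_refl _ _)).trans
    (Asymptotics.IsBigO.of_norm_le fun n => ?_)
  have h5 : (0 : ℝ) < n + 1 := by positivity
  push_cast
  rw [Real.norm_of_nonneg (by positivity), ← Real.rpow_natCast, ← Real.rpow_neg h5.le,
    ← Real.rpow_add h5, ← Real.rpow_neg h5.le]
  norm_num

lemma tendsto_harm_pow_div (r : ℕ) :
    Tendsto (fun n : ℕ => harm (n + 1) ^ r / ((n : ℝ) + 1)) atTop (𝓝 0) := by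
  have hcast : Tendsto (fun n : ℕ => (n : ℝ) + 1) atTop atTop :=
    tendsto_atTop_add_const_right _ _ tendsto_natCast_atTop_atTop
  have hlim := (tendsto_rpow_neg_atTop (show (0 : ℝ) < 1 / 2 by norm_num)).comp hcast
  refine Asymptotics.IsBigO.trans_tendsto ?_ hlim
  simp only [div_eq_mul_inv]
  refine ((harm_pow_isBigO r).mul (Asymptotics.isBigO_refl _ _)).trans
    (Asymptotics.IsBigO.of_norm_le fun n => ?_)
  have h5 : (0 : ℝ) < n + 1 := by positivity
  simp only [Function.comp]
  rw [Real.norm_of_nonneg (by positivity), ← Real.rpow_neg_one, ← Real.rpow_add h5]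
  norm_num

/-! ### Generating series in the depth -/

/-- `∑ₖ tₙ(1ₖ) xᵏ = ∏_{j ≤ n} (1 + x/(2j-1))`. -/
def tSeries (n : ℕ) : PowerSeries ℝ := PowerSeries.mk fun k => tSum (List.replicate k 1) n

/-- `∑ₖ t⋆ₙ(1ₖ) xᵏ = ∏_{j ≤ n} (1 - x/(2j-1))⁻¹`. -/
def tStarSeries (n : ℕ) : PowerSeries ℝ := PowerSeries.mk fun k => tStarSum (List.replicate k 1) n

/-- The coefficient `∑ₖ tₙ(1ₖ) t⋆ₙ₊₁(1_{m-k})` of `xᵐ` in `tSeries n * tStarSeries (n + 1)`. -/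
def tProduct (m n : ℕ) : ℝ :=
  ∑ k ∈ Finset.range (m + 1),
    tSum (List.replicate k 1) n * tStarSum (List.replicate (m - k) 1) (n + 1)

lemma coeff_tSeries_mul_tStarSeries (m n : ℕ) :
    PowerSeries.coeff m (tSeries n * tStarSeries (n + 1)) = tProduct m n := by
  rw [PowerSeries.coeff_mul, tProduct]
  simp only [tSeries, tStarSeries, PowerSeries.coeff_mk]
  exact Finset.Nat.sum_antidiagonal_eq_sum_range_succ
    (fun i j => tSum (List.replicate i 1) n * tStarSum (List.replicate j 1) (n + 1)) m

lemma tSeries_zero : tSeries 0 = 1 := by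
  ext m
  cases m with
  | zero => simp [tSeries, tSum]
  | succ m => simp [tSeries, List.replicate_succ, tSum_cons_zero, PowerSeries.coeff_one]

lemma tStarSeries_zero : tStarSeries 0 = 1 := by
  ext m
  cases m with
  | zero => simp [tStarSeries, tStarSum]
  | succ m => simp [tStarSeries, List.replicate_succ, tStarSum_cons_zero, PowerSeries.coeff_one]

lemma tSeries_succ (n : ℕ) :
    tSeries (n + 1)
      = tSeries n * (1 + PowerSeries.C (1 / (2 * (n : ℝ) + 1)) * PowerSeries.X) := by
  ext m
  rw [mul_add, mul_one, map_add, mul_left_comm, PowerSeries.coeff_C_mul]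
  cases m with
  | zero => simp [tSeries, tSum]
  | succ m =>
    rw [PowerSeries.coeff_succ_mul_X]
    simp [tSeries, List.replicate_succ, tSum_cons_succ]

lemma tStarSeries_succ_mul (n : ℕ) :
    tStarSeries (n + 1) * (1 - PowerSeries.C (1 / (2 * (n : ℝ) + 1)) * PowerSeries.X)
      = tStarSeries n := by
  ext m
  rw [mul_sub, mul_one, map_sub, mul_left_comm, PowerSeries.coeff_C_mul]
  cases m with
  | zero => simp [tStarSeries, tStarSum]
  | succ m =>
    rw [PowerSeries.coeff_succ_mul_X]
    simp [tStarSeries, List.replicate_succ, tStarSum_cons_succ]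

/-- The well-poised partial sum behind the Legendre expansion of a monomial: the summand
telescopes in `n`. -/
lemma sum_legendreMoment_mul_series (k N : ℕ) :
    (PowerSeries.C (2 * (k : ℝ) + 1) - PowerSeries.X) *
        ∑ n ∈ Finset.range N, PowerSeries.C ((-1) ^ n * legendreMoment k n) *
          (tSeries n * tStarSeries (n + 1))
      = 1 - PowerSeries.C ((-1) ^ N * legendreMoment k N * (k + N + 1)) *
          (tSeries N * tStarSeries N) := by
  induction N with
  | zero =>
    have : ((k : ℝ) + 1)⁻¹ * (k + 1) = 1 := inv_mul_cancel₀ (by positivity)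
    simp [legendreMoment, tSeries_zero, tStarSeries_zero, this]
  | succ N ih =>
    rw [Finset.sum_range_succ, mul_add, ih, tSeries_succ, ← tStarSeries_succ_mul N]
    have h1 : (-1) ^ (N + 1) * legendreMoment k (N + 1) * ((k : ℝ) + ((N + 1 : ℕ) : ℝ) + 1)
        = -((-1) ^ N * legendreMoment k N * (k - N)) := by
      have := legendreMoment_succ_mul k N
      push_cast
      linear_combination (-(-1) ^ N) * this
    rw [h1]
    -- With `y = 1/(2N+1)`: `(k+N+1)(1-yX) + (k-N)(1+yX) = 2k+1-X`.
    have h2 : PowerSeries.C (1 / (2 * (N : ℝ) + 1)) * PowerSeries.C (2 * (N : ℝ) + 1) = 1 := by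
      rw [← map_mul, one_div, inv_mul_cancel₀ (by positivity), map_one]
    generalize PowerSeries.C (1 / (2 * (N : ℝ) + 1)) = y at *
    have h3 : PowerSeries.C (2 * (N : ℝ) + 1) = 2 * PowerSeries.C (N : ℝ) + 1 := by
      rw [map_add, map_mul, map_ofNat, map_one]
    have h4 : PowerSeries.C (2 * (k : ℝ) + 1) = 2 * PowerSeries.C (k : ℝ) + 1 := by
      rw [map_add, map_mul, map_ofNat, map_one]
    rw [h3] at h2
    rw [h4]
    simp only [map_mul, map_neg, map_add, map_sub, map_one]
    linear_combination (PowerSeries.C ((-1 : ℝ) ^ N) * PowerSeries.C (legendreMoment k N) *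
      tSeries N * tStarSeries (N + 1) * PowerSeries.X) * h2

lemma coeff_of_linear_mul_eq_one {c : ℝ} (hc : c ≠ 0) {f : PowerSeries ℝ}
    (h : (PowerSeries.C c - PowerSeries.X) * f = 1) (m : ℕ) :
    PowerSeries.coeff m f = 1 / c ^ (m + 1) := by
  rw [sub_mul] at h
  induction m with
  | zero =>
    have := congrArg (PowerSeries.coeff 0) h
    rw [map_sub, PowerSeries.coeff_C_mul] at this
    simp at this
    simp
    field_simp
    linarith
  | succ m ih =>
    have := congrArg (PowerSeries.coeff (m + 1)) h
    rw [map_sub, PowerSeries.coeff_C_mul, PowerSeries.coeff_succ_X_mul, ih] at this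
    simp [PowerSeries.coeff_one] at this
    rw [pow_succ]
    field_simp at *
    linarith

/-- The expansion of a monomial in shifted Legendre polynomials, after the Mellin transform and
coefficient extraction. -/
lemma sum_legendreMoment_mul_tProduct (k m : ℕ) :
    ∑ n ∈ Finset.range (k + 1), (-1) ^ n * legendreMoment k n * tProduct m n
      = 1 / (2 * (k : ℝ) + 1) ^ (m + 1) := by
  have h := sum_legendreMoment_mul_series k (k + 1)
  rw [legendreMoment_eq_zero (Nat.lt_succ_self k)] at h
  simp only [mul_zero, zero_mul, map_zero, sub_zero] at h
  rw [← coeff_of_linear_mul_eq_one (by positivity) h m, map_sum]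
  simp only [PowerSeries.coeff_C_mul, coeff_tSeries_mul_tStarSeries]

/-! ### The Apéry-type series as a sum of products -/

lemma tProduct_nonneg (m n : ℕ) : 0 ≤ tProduct m n :=
  Finset.sum_nonneg fun _ _ => mul_nonneg (tSum_nonneg _ _) (tStarSum_nonneg _ _)

lemma summable_tSum_mul_tStarSum_div_sq (k l : ℕ) :
    Summable fun n : ℕ => tSum (List.replicate k 1) n * tStarSum (List.replicate l 1) (n + 1)
      / (2 * (n : ℝ) + 1) ^ 2 := by
  refine Summable.of_nonneg_of_le (fun n => ?_) (fun n => ?_) (summable_harm_pow_div_sq (k + l))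
  · have := tSum_nonneg (List.replicate k 1) n
    have := tStarSum_nonneg (List.replicate l 1) (n + 1)
    positivity
  · have h1 : tSum (List.replicate k 1) n ≤ harm (n + 1) ^ k := by
      have h := tSum_le_harm_pow (l := List.replicate k 1)
        (fun a ha => (List.eq_of_mem_replicate ha).ge) n
      rw [List.length_replicate] at h
      exact h.trans (pow_le_pow_left₀ (harm_nonneg n) (harm_mono n.le_succ) k)
    have h2 : tStarSum (List.replicate l 1) (n + 1) ≤ harm (n + 1) ^ l := by
      have h := tStarSum_le_harm_pow (l := List.replicate l 1)
        (fun a ha => (List.eq_of_mem_replicate ha).ge) (n + 1)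
      rwa [List.length_replicate] at h
    have h3 : (n : ℝ) + 1 ≤ 2 * n + 1 := by linarith [n.cast_nonneg (α := ℝ)]
    rw [pow_add]
    have h4 := harm_nonneg (n + 1)
    have h5 := tStarSum_nonneg (List.replicate l 1) (n + 1)
    gcongr

lemma summable_tProductTerm (k l : ℕ) : Summable (tProductTerm k l) := by
  refine Summable.of_norm ((summable_tSum_mul_tStarSum_div_sq k l).congr fun n => ?_)
  have := tSum_nonneg (List.replicate k 1) n
  have := tStarSum_nonneg (List.replicate l 1) (n + 1)
  rw [tProductTerm, mul_div_assoc (_ ^ n), norm_mul, norm_pow, norm_neg, norm_one, one_pow, one_mul,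
    Real.norm_of_nonneg (by positivity)]

lemma summable_tProduct_div_sq (m : ℕ) :
    Summable fun n : ℕ => tProduct m n / (2 * (n : ℝ) + 1) ^ 2 := by
  simp only [tProduct, Finset.sum_div]
  exact summable_sum fun k _ => summable_tSum_mul_tStarSum_div_sq k (m - k)

lemma sum_tProductTerm (m n : ℕ) :
    ∑ k ∈ Finset.range (m + 1), tProductTerm k (m - k) n
      = (-1) ^ n * tProduct m n / (2 * (n : ℝ) + 1) ^ 2 := by
  simp only [tProductTerm, tProduct, Finset.mul_sum, Finset.sum_div]

/-- Both evaluations of the absolutely convergent double sum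
`∑ₖ ∑ₙ centralSq k * (-1)ⁿ * legendreMoment k n * tProduct m n`. -/
lemma hasSum_aperyTerm (m : ℕ) :
    HasSum (aperyTerm m)
      (4 / Real.pi * ∑' n : ℕ, (-1) ^ n * tProduct m n / (2 * (n : ℝ) + 1) ^ 2) := by
  set f : ℕ × ℕ → ℝ :=
    fun p => (-1) ^ p.1 * tProduct m p.1 * (centralSq p.2 * legendreMoment p.2 p.1) with hf
  have hnorm : ∀ n k, ‖f (n, k)‖ = tProduct m n * (centralSq k * legendreMoment k n) := by
    intro n k
    rw [hf]
    dsimp only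
    rw [norm_mul, norm_mul, norm_pow, norm_neg, norm_one, one_pow, one_mul,
      Real.norm_of_nonneg (tProduct_nonneg m n), Real.norm_of_nonneg
        (mul_nonneg (centralSq_nonneg k) (legendreMoment_nonneg k n))]
  have hfs : Summable f := by
    refine Summable.of_norm ((summable_prod_of_nonneg fun p => norm_nonneg _).2 ⟨fun n => ?_, ?_⟩)
    · simp only [hnorm]
      exact (hasSum_centralSq_mul_legendreMoment n).summable.mul_left _
    · simp only [hnorm, tsum_mul_left, (hasSum_centralSq_mul_legendreMoment _).tsum_eq]
      exact ((summable_tProduct_div_sq m).mul_left (4 / Real.pi)).congr fun n => by ring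
  -- Summation over `k` first.
  have h1 : HasSum (fun n : ℕ => 4 / Real.pi * ((-1) ^ n * tProduct m n / (2 * (n : ℝ) + 1) ^ 2))
      (∑' p, f p) := by
    refine hfs.hasSum.prod_fiberwise fun n => ?_
    have h := (hasSum_centralSq_mul_legendreMoment n).mul_left ((-1) ^ n * tProduct m n)
    rwa [show (-1) ^ n * tProduct m n * (4 / Real.pi * (1 / (2 * (n : ℝ) + 1) ^ 2))
      = 4 / Real.pi * ((-1) ^ n * tProduct m n / (2 * (n : ℝ) + 1) ^ 2) by ring] at h
  -- Summation over `n` first: the inner sum is finite.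
  have h2 : HasSum (aperyTerm m) (∑' p, f p) := by
    refine ((Equiv.prodComm ℕ ℕ).hasSum_iff.2 hfs.hasSum).prod_fiberwise fun k => ?_
    have : aperyTerm m k = ∑ n ∈ Finset.range (k + 1), f (n, k) := by
      have h := sum_legendreMoment_mul_tProduct k m
      rw [aperyTerm, ← centralSq, div_eq_mul_one_div, ← h, Finset.mul_sum]
      refine Finset.sum_congr rfl fun n _ => ?_
      rw [hf]
      ring
    rw [this]
    refine hasSum_sum_of_ne_finset_zero fun n hn => ?_
    simp only [Finset.mem_range, not_lt] at hn
    simp [hf, legendreMoment_eq_zero (show k < n by omega)]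
  rwa [← tsum_mul_left, h1.tsum_eq]

/-! ### Expansion over compositions -/

lemma sum_composition_zero (F : List ℕ → ℝ) : ∑ s : Composition 0, F s.blocks = F [] := by
  rw [Finset.sum_congr rfl fun s _ => congrArg F (s.blocks_eq_nil.2 rfl), Finset.sum_const,
    Finset.card_univ, composition_card]
  simp

/-- Splitting off the first block of a composition. -/
lemma sum_composition_succ (F : List ℕ → ℝ) (w : ℕ) :
    ∑ s : Composition (w + 1), F s.blocks
      = ∑ p ∈ Finset.HasAntidiagonal.antidiagonal w, ∑ s : Composition p.2, F ((p.1 + 1) :: s.blocks) := by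
  rw [Finset.sum_sigma']
  symm
  refine Finset.sum_bij (fun x hx => ⟨(x.1.1 + 1) :: x.2.blocks, ?_, ?_⟩) ?_ ?_ ?_ ?_
  · intro i hi
    rcases List.mem_cons.1 hi with rfl | hi
    · omega
    · exact x.2.blocks_pos hi
  · have := Finset.HasAntidiagonal.mem_antidiagonal.1 (Finset.mem_sigma.1 hx).1
    rw [List.sum_cons, x.2.blocks_sum]
    omega
  · intros; exact Finset.mem_univ _
  · rintro ⟨⟨a, b⟩, s⟩ hs ⟨⟨a', b'⟩, s'⟩ hs' h
    simp only [Composition.mk.injEq, List.cons.injEq, Nat.add_right_cancel_iff] at h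
    obtain ⟨rfl, h⟩ := h
    have hb : b = b' :=
      s.blocks_sum.symm.trans ((congrArg List.sum h).trans s'.blocks_sum)
    subst hb
    rw [Composition.ext h]
  · rintro ⟨blocks, hpos, hsum⟩ -
    cases blocks with
    | nil => simp at hsum
    | cons a l =>
      have ha : 0 < a := hpos (List.mem_cons_self ..)
      rw [List.sum_cons] at hsum
      refine ⟨⟨(a - 1, l.sum), ⟨l, fun h => hpos (List.mem_cons_of_mem _ h), rfl⟩⟩, ?_, ?_⟩
      · simp only [Finset.mem_sigma, Finset.HasAntidiagonal.mem_antidiagonal, Finset.mem_univ, and_true]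
        omega
      · simp only [Composition.mk.injEq, List.cons.injEq, and_true]
        omega
  · intros; rfl

/-- `∑_w xʷ ∑_{s ⊢ w} 2^{length s} tₙ(s) = ∏_{j ≤ n} (1 + 2 ∑_{s ≥ 1} xˢ/(2j-1)ˢ)`. -/
def compositionSeries (n : ℕ) : PowerSeries ℝ :=
  PowerSeries.mk fun w => ∑ s : Composition w, 2 ^ s.blocks.length * tSum s.blocks n

/-- The geometric series `(1 - x/(2n+1))⁻¹`. -/
def geomSeries (n : ℕ) : PowerSeries ℝ := PowerSeries.mk fun i => (1 / (2 * (n : ℝ) + 1)) ^ i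

lemma geomSeries_mul (n : ℕ) :
    geomSeries n * (1 - PowerSeries.C (1 / (2 * (n : ℝ) + 1)) * PowerSeries.X) = 1 := by
  ext m
  rw [mul_sub, mul_one, map_sub, mul_left_comm, PowerSeries.coeff_C_mul]
  cases m with
  | zero => simp [geomSeries]
  | succ m =>
    rw [PowerSeries.coeff_succ_mul_X]
    simp only [geomSeries, PowerSeries.coeff_mk, PowerSeries.coeff_one]
    simp [pow_succ']

lemma tStarSeries_succ (n : ℕ) : tStarSeries (n + 1) = tStarSeries n * geomSeries n := by
  linear_combination (tStarSeries (n + 1)) * (-geomSeries_mul n)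
    + geomSeries n * tStarSeries_succ_mul n

lemma compositionSeries_zero : compositionSeries 0 = 1 := by
  ext m
  cases m with
  | zero =>
    simp only [compositionSeries, PowerSeries.coeff_mk]
    rw [sum_composition_zero (fun l => 2 ^ l.length * tSum l 0)]
    simp [tSum]
  | succ m =>
    simp only [compositionSeries, PowerSeries.coeff_mk]
    rw [sum_composition_succ (fun l => 2 ^ l.length * tSum l 0)]
    simp [tSum_cons_zero, PowerSeries.coeff_one]

lemma compositionSeries_succ (n : ℕ) :
    compositionSeries (n + 1) = compositionSeries n +
      PowerSeries.C (2 * (1 / (2 * (n : ℝ) + 1))) * (geomSeries n * compositionSeries n)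
        * PowerSeries.X := by
  ext m
  rw [map_add]
  cases m with
  | zero =>
    simp only [compositionSeries, PowerSeries.coeff_mk, PowerSeries.coeff_zero_mul_X, add_zero]
    rw [sum_composition_zero (fun l => 2 ^ l.length * tSum l (n + 1)),
      sum_composition_zero (fun l => 2 ^ l.length * tSum l n)]
    simp [tSum]
  | succ m =>
    rw [PowerSeries.coeff_succ_mul_X, PowerSeries.coeff_C_mul, PowerSeries.coeff_mul]
    simp only [compositionSeries, geomSeries, PowerSeries.coeff_mk]
    rw [sum_composition_succ (fun l => 2 ^ l.length * tSum l (n + 1)),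
      sum_composition_succ (fun l => 2 ^ l.length * tSum l n), Finset.mul_sum,
      ← Finset.sum_add_distrib]
    refine Finset.sum_congr rfl fun p _ => ?_
    rw [Finset.mul_sum, Finset.mul_sum, ← Finset.sum_add_distrib]
    refine Finset.sum_congr rfl fun s _ => ?_
    rw [tSum_cons_succ, List.length_cons, ← one_div_pow]
    ring

lemma compositionSeries_eq (n : ℕ) : compositionSeries n = tSeries n * tStarSeries n := by
  induction n with
  | zero => rw [compositionSeries_zero, tSeries_zero, tStarSeries_zero, one_mul]
  | succ n ih =>
    rw [compositionSeries_succ, ih, tSeries_succ, tStarSeries_succ, map_mul]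
    have : PowerSeries.C (2 : ℝ) = 2 := map_ofNat _ 2
    rw [this]
    linear_combination (-(tSeries n * tStarSeries n)) * geomSeries_mul n

/-- The terms of the signed sums, grouped over all compositions of `m + 2` with first
block at least `2`. -/
lemma sum_composition_tSum (m n : ℕ) :
    ∑ s : Composition (m + 2) with 2 ≤ s.blocks.headI,
        2 ^ s.blocks.length * (1 / (2 * (n : ℝ) + 1) ^ s.blocks.headI * tSum s.blocks.tail n)
      = 2 * (tProduct m n / (2 * (n : ℝ) + 1) ^ 2) := by
  rw [Finset.sum_filter, sum_composition_succ (fun l => if 2 ≤ l.headI then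
    2 ^ l.length * (1 / (2 * (n : ℝ) + 1) ^ l.headI * tSum l.tail n) else 0) (m + 1),
    Finset.Nat.sum_antidiagonal_succ, ← coeff_tSeries_mul_tStarSeries,
    tStarSeries_succ, ← mul_assoc, ← compositionSeries_eq, mul_comm (compositionSeries n),
    PowerSeries.coeff_mul]
  simp only [List.headI_cons, List.tail_cons, List.length_cons, zero_add, Nat.not_ofNat_le_one,
    if_false, Finset.sum_const_zero, compositionSeries, geomSeries, PowerSeries.coeff_mk]
  rw [Finset.sum_div, Finset.mul_sum]
  refine Finset.sum_congr rfl fun p _ => ?_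
  rw [Finset.mul_sum, Finset.sum_div, Finset.mul_sum]
  refine Finset.sum_congr rfl fun s _ => ?_
  refine (if_pos (show 2 ≤ p.1 + 1 + 1 by omega)).trans ?_
  rw [one_div_pow]
  have : (2 * (n : ℝ) + 1) ≠ 0 := by positivity
  field_simp
  ring

/-! ### Convergence of colored sums -/

/-- The operator adding an outermost summation with exponent `k` and argument `z` to a nested
sum. -/
def nestSum (k : ℕ) (z : ℂ) : (ℕ → ℂ) →ₗ[ℚ] (ℕ → ℂ) where
  toFun f n := ∑ j ∈ Finset.range n, z ^ (j + 1) / ((j : ℂ) + 1) ^ k * f j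
  map_add' f g := by
    funext n
    simp only [Pi.add_apply, mul_add, Finset.sum_add_distrib]
  map_smul' c f := by
    funext n
    simp only [Pi.smul_apply, mul_smul_comm, ← Finset.smul_sum, RingHom.id_apply]

lemma nestSum_apply (k : ℕ) (z : ℂ) (f : ℕ → ℂ) (n : ℕ) :
    nestSum k z f n = ∑ j ∈ Finset.range n, z ^ (j + 1) / ((j : ℂ) + 1) ^ k * f j := rfl

lemma coloredSum_cons (k : ℕ) (z : ℂ) (l : List (ℕ × ℂ)) :
    coloredSum ((k, z) :: l) = nestSum k z (coloredSum l) := by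
  funext n
  rw [nestSum_apply]
  induction n with
  | zero => rw [coloredSum_cons_zero, Finset.sum_range_zero]
  | succ n ih => rw [coloredSum_cons_succ, ih, Finset.sum_range_succ, Nat.cast_succ]

lemma signedTSum_cons_eq_sum_range (k : ℕ) (ε : ℝ) (l : List (ℕ × ℝ)) (n : ℕ) :
    signedTSum ((k, ε) :: l) n
      = ∑ j ∈ Finset.range n, ε ^ (j + 1) / (2 * (j : ℝ) + 1) ^ k * signedTSum l j := by
  induction n with
  | zero => rw [signedTSum_cons_zero, Finset.sum_range_zero]
  | succ n ih => rw [signedTSum_cons_succ, ih, Finset.sum_range_succ]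

lemma one_le_harm_succ (n : ℕ) : 1 ≤ harm (n + 1) := by
  have h : harm 1 = 1 := by simp [harm]
  rw [← h]
  exact harm_mono (by omega)

lemma norm_coloredSum_succ_sub_le {l : List (ℕ × ℂ)} (hl : ∀ p ∈ l, 1 ≤ p.1 ∧ ‖p.2‖ ≤ 1)
    (n : ℕ) : ‖coloredSum l (n + 1) - coloredSum l n‖ ≤ harm (n + 1) ^ l.length / ((n : ℝ) + 1) := by
  cases l with
  | nil => simp [coloredSum]; positivity
  | cons p l =>
    obtain ⟨k, z⟩ := p
    simp only [List.mem_cons, forall_eq_or_imp] at hl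
    rw [coloredSum_cons_succ, add_sub_cancel_left, norm_mul, norm_div, norm_pow, norm_pow,
      Complex.norm_natCast, List.length_cons]
    push_cast
    have h1 : (1 : ℝ) ≤ n + 1 := by linarith [n.cast_nonneg (α := ℝ)]
    have h2 : ‖coloredSum l n‖ ≤ harm (n + 1) ^ (l.length + 1) :=
      calc ‖coloredSum l n‖ ≤ harm n ^ l.length := norm_coloredSum_le_harm_pow hl.2 n
        _ ≤ harm (n + 1) ^ l.length := pow_le_pow_left₀ (harm_nonneg n) (harm_mono n.le_succ) _
        _ ≤ harm (n + 1) ^ (l.length + 1) :=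
          pow_le_pow_right₀ (one_le_harm_succ n) (Nat.le_succ _)
    have h3 : ‖z‖ ^ (n + 1) / ((n : ℝ) + 1) ^ k ≤ 1 / ((n : ℝ) + 1) := by
      gcongr
      · exact pow_le_one₀ (norm_nonneg _) hl.1.2
      · exact le_self_pow₀ h1 (by have := hl.1.1; omega)
    calc ‖z‖ ^ (n + 1) / ((n : ℝ) + 1) ^ k * ‖coloredSum l n‖
        ≤ 1 / ((n : ℝ) + 1) * harm (n + 1) ^ (l.length + 1) :=
          mul_le_mul h3 h2 (norm_nonneg _) (by positivity)
      _ = _ := by ring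

/-- Abel summation: the nested sum converges when the outermost factor is `zʲ/j` with `z ≠ 1` on
the unit circle. -/
lemma exists_tendsto_nestSum_one {z : ℂ} (hz : ‖z‖ = 1) (hz1 : z ≠ 1) {l : List (ℕ × ℂ)}
    (hl : ∀ p ∈ l, 1 ≤ p.1 ∧ ‖p.2‖ ≤ 1) :
    ∃ L, Tendsto (nestSum 1 z (coloredSum l)) atTop (𝓝 L) := by
  -- The sequence `b` tends to `0` and has bounded variation.
  set b : ℕ → ℂ := fun j => coloredSum l j / ((j : ℂ) + 1) with hb
  have hne : ∀ j : ℕ, ((j : ℂ) + 1) ≠ 0 := fun j => Nat.cast_add_one_ne_zero j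
  have hparts : ∀ n, nestSum 1 z (coloredSum l) n
      = (z * b 0 - z ^ (n + 1) * b n
        + ∑ j ∈ Finset.range n, z ^ (j + 2) * (b (j + 1) - b j)) / (1 - z) := by
    intro n
    rw [eq_div_iff (sub_ne_zero.2 hz1.symm), nestSum_apply]
    induction n with
    | zero => simp
    | succ n ih =>
      rw [Finset.sum_range_succ, Finset.sum_range_succ, add_mul, ih]
      have : z ^ (n + 1) / ((n : ℂ) + 1) ^ 1 * coloredSum l n = z ^ (n + 1) * b n := by
        rw [hb]; ring
      rw [this]
      ring
  have hH : ∀ n, ‖coloredSum l n‖ ≤ harm (n + 1) ^ l.length := fun n =>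
    (norm_coloredSum_le_harm_pow hl n).trans
      (pow_le_pow_left₀ (harm_nonneg n) (harm_mono n.le_succ) _)
  have hnorm : ∀ n : ℕ, ‖(n : ℂ) + 1‖ = (n : ℝ) + 1 := fun n => by
    rw [← Nat.cast_succ, Complex.norm_natCast, Nat.cast_succ]
  have hb0 : Tendsto (fun n => z ^ (n + 1) * b n) atTop (𝓝 0) := by
    refine squeeze_zero_norm (fun n => ?_) (tendsto_harm_pow_div l.length)
    rw [norm_mul, norm_pow, hz, one_pow, one_mul, hb, norm_div, hnorm]
    have := hH n
    gcongr
  have hsum : Summable fun j => z ^ (j + 2) * (b (j + 1) - b j) := by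
    refine Summable.of_norm_bounded ((summable_harm_pow_div_sq l.length).mul_left 2) fun n => ?_
    have h0 := harm_nonneg (n + 1)
    have hsplit : b (n + 1) - b n
        = (coloredSum l (n + 1) - coloredSum l n) / (((n + 1 : ℕ) : ℂ) + 1)
          - coloredSum l n / (((n : ℂ) + 1) * (((n + 1 : ℕ) : ℂ) + 1)) := by
      have h1 := hne n
      have h2 := hne (n + 1)
      simp only [hb]
      field_simp
      push_cast
      ring
    have h3 : (n : ℝ) + 1 ≤ ((n + 1 : ℕ) : ℝ) + 1 := by push_cast; linarith
    rw [norm_mul, norm_pow, hz, one_pow, one_mul, hsplit]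
    calc _ ≤ ‖(coloredSum l (n + 1) - coloredSum l n) / (((n + 1 : ℕ) : ℂ) + 1)‖
          + ‖coloredSum l n / (((n : ℂ) + 1) * (((n + 1 : ℕ) : ℂ) + 1))‖ := norm_sub_le _ _
      _ ≤ harm (n + 1) ^ l.length / ((n : ℝ) + 1) / ((n : ℝ) + 1)
          + harm (n + 1) ^ l.length / (((n : ℝ) + 1) * ((n : ℝ) + 1)) := by
        rw [norm_div, norm_div, norm_mul, hnorm, hnorm]
        have h4 := norm_coloredSum_succ_sub_le hl n
        have h5 := hH n
        gcongr
      _ = _ := by field_simp; ring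
  refine ⟨_, Tendsto.congr (fun n => (hparts n).symm)
    (((tendsto_const_nhds.sub hb0).add hsum.hasSum.tendsto_sum_nat).div_const _)⟩

/-- Truncated colored sums converge under the admissibility condition. -/
lemma tendsto_coloredSum {l : List (ℕ × ℂ)} (hl : Admissible l) (hz : ∀ p ∈ l, ‖p.2‖ = 1) :
    Tendsto (coloredSum l) atTop (𝓝 (cmzv l)) := by
  suffices ∃ L, Tendsto (coloredSum l) atTop (𝓝 L) from tendsto_nhds_limUnder this
  rcases l with _ | ⟨⟨k, z⟩, l⟩
  · exact ⟨1, tendsto_const_nhds⟩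
  obtain ⟨hk, hhead⟩ := hl
  simp only [List.mem_cons, forall_eq_or_imp] at hk hz
  have hhead := hhead (k, z) (by simp)
  have hl : ∀ p ∈ l, 1 ≤ p.1 ∧ ‖p.2‖ ≤ 1 := fun p hp => ⟨hk.2 p hp, (hz.2 p hp).le⟩
  rw [coloredSum_cons]
  -- Convergence is conditional for `k = 1` and absolute for `k ≥ 2`.
  rcases hk.1.eq_or_lt with h1 | h2
  · subst h1
    exact exists_tendsto_nestSum_one hz.1 (fun h => hhead (by rw [h])) hl
  · have hsum : Summable fun j : ℕ => z ^ (j + 1) / ((j : ℂ) + 1) ^ k * coloredSum l j := by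
      refine Summable.of_norm_bounded (summable_harm_pow_div_sq l.length) fun n => ?_
      have h0 := harm_nonneg (n + 1)
      have h3 : (1 : ℝ) ≤ (n : ℝ) + 1 := by linarith [n.cast_nonneg (α := ℝ)]
      rw [norm_mul, norm_div, norm_pow, norm_pow, hz.1, one_pow, ← Nat.cast_succ,
        Complex.norm_natCast, Nat.cast_succ, div_mul_eq_mul_div, one_mul]
      have h4 : ‖coloredSum l n‖ ≤ harm (n + 1) ^ l.length :=
        (norm_coloredSum_le_harm_pow hl n).trans
          (pow_le_pow_left₀ (harm_nonneg n) (harm_mono n.le_succ) _)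
      have h5 : 2 ≤ k := h2
      gcongr
    exact ⟨_, hsum.hasSum.tendsto_sum_nat⟩

/-! ### Multiple t-values as colored multiple zeta values of level four -/

/-- `(k, z)` is one of the colored entries contributed by the signed entry `(k, ε)`; these are the
arguments that detect odd integers: `z = ±1` for `ε = 1`, and `z = ±i` for `ε = -1`. -/
def IsLift (p : ℕ × ℝ) (q : ℕ × ℂ) : Prop :=
  q.1 = p.1 ∧ (p.2 = 1 ∧ (q.2 = 1 ∨ q.2 = -1) ∨
    p.2 = -1 ∧ (q.2 = Complex.I ∨ q.2 = -Complex.I))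

/-- The `ℚ`-space of sequences of truncated colored sums whose arguments lift those of `l`. -/
def liftSpan (l : List (ℕ × ℝ)) : Submodule ℚ (ℕ → ℂ) :=
  Submodule.span ℚ {f | ∃ l', List.Forall₂ IsLift l l' ∧ f = coloredSum l'}

/-- The factor `i^r`, where `r` is the number of signs equal to `-1`. -/
def signFactor : List (ℕ × ℝ) → ℂ
  | [] => 1
  | (_, ε) :: l => (if ε = -1 then Complex.I else 1) * signFactor l

lemma nestSum_mem_liftSpan {k : ℕ} {ε : ℝ} {z : ℂ} {l : List (ℕ × ℝ)} {g : ℕ → ℂ}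
    (hg : g ∈ liftSpan l) (h : IsLift (k, ε) (k, z)) : nestSum k z g ∈ liftSpan ((k, ε) :: l) := by
  have : liftSpan l ≤ (liftSpan ((k, ε) :: l)).comap (nestSum k z) := by
    refine Submodule.span_le.2 ?_
    rintro f ⟨l', hl', rfl⟩
    refine Submodule.subset_span ⟨(k, z) :: l', List.Forall₂.cons h hl', ?_⟩
    rw [coloredSum_cons]
  exact this hg

/-- Opposite arguments cancel at the even indices. -/
lemma nestSum_sub_nestSum_neg (k : ℕ) (z : ℂ) (g : ℕ → ℂ) (n : ℕ) :
    nestSum k z g (2 * n) - nestSum k (-z) g (2 * n)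
      = ∑ j ∈ Finset.range n, 2 * (z ^ (2 * j + 1) / (2 * (j : ℂ) + 1) ^ k * g (2 * j)) := by
  simp only [nestSum_apply]
  induction n with
  | zero => simp
  | succ n ih =>
    rw [show 2 * (n + 1) = 2 * n + 1 + 1 by ring, Finset.sum_range_succ _ (2 * n + 1),
      Finset.sum_range_succ _ (2 * n), Finset.sum_range_succ _ (2 * n + 1),
      Finset.sum_range_succ _ (2 * n), Finset.sum_range_succ _ n, ← ih,
      Odd.neg_pow (show Odd (2 * n + 1) from ⟨n, rfl⟩),
      Even.neg_pow (show Even (2 * n + 1 + 1) from ⟨n + 1, by ring⟩)]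
    push_cast
    ring

/-- Substituting `N = 2n - 1` turns a signed truncated `t`-sum into colored sums. -/
lemma exists_mem_liftSpan {l : List (ℕ × ℝ)} (hl : ∀ p ∈ l, p.2 = 1 ∨ p.2 = -1) :
    ∃ g ∈ liftSpan l, ∀ n, ((signedTSum l n : ℝ) : ℂ) = signFactor l * g (2 * n) := by
  induction l with
  | nil =>
    refine ⟨coloredSum [], Submodule.subset_span ⟨[], List.Forall₂.nil, rfl⟩, fun n => ?_⟩
    simp [signedTSum, coloredSum, signFactor]
  | cons p l ih =>
    obtain ⟨k, ε⟩ := p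
    simp only [List.mem_cons, forall_eq_or_imp] at hl
    obtain ⟨g, hg, hgl⟩ := ih hl.2
    -- `z = 1` for the sign `1` and `z = i` for the sign `-1`.
    obtain ⟨z, hz, hz', hzε⟩ : ∃ z : ℂ, IsLift (k, ε) (k, z) ∧ IsLift (k, ε) (k, -z) ∧
        ∀ j : ℕ, (ε : ℂ) ^ (j + 1) = (if ε = -1 then Complex.I else 1) * z ^ (2 * j + 1) := by
      rcases hl.1 with h | h
      · subst h
        refine ⟨1, ⟨rfl, Or.inl ⟨rfl, Or.inl rfl⟩⟩, ⟨rfl, Or.inl ⟨rfl, Or.inr rfl⟩⟩, fun j => ?_⟩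
        rw [if_neg (by norm_num)]
        simp
      · subst h
        refine ⟨Complex.I, ⟨rfl, Or.inr ⟨rfl, Or.inl rfl⟩⟩, ⟨rfl, Or.inr ⟨rfl, Or.inr rfl⟩⟩,
          fun j => ?_⟩
        rw [if_pos rfl, pow_succ Complex.I, pow_mul, Complex.I_sq, mul_left_comm, Complex.I_mul_I]
        push_cast
        ring
    refine ⟨(1 / 2 : ℚ) • (nestSum k z g - nestSum k (-z) g), Submodule.smul_mem _ _
      (Submodule.sub_mem _ (nestSum_mem_liftSpan hg hz) (nestSum_mem_liftSpan hg hz')),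
      fun n => ?_⟩
    rw [Pi.smul_apply, Pi.sub_apply, nestSum_sub_nestSum_neg, ← Finset.mul_sum,
      signedTSum_cons_eq_sum_range, signFactor, Rat.smul_def]
    push_cast
    rw [← mul_assoc (1 / 2 : ℂ), show (1 / 2 : ℂ) * 2 = 1 by norm_num, one_mul, Finset.mul_sum]
    refine Finset.sum_congr rfl fun j _ => ?_
    rw [hgl, hzε]
    ring

lemma IsLift.pow_four {p : ℕ × ℝ} {q : ℕ × ℂ} (h : IsLift p q) : q.2 ^ 4 = 1 := by
  obtain ⟨-, ⟨-, h | h⟩ | ⟨-, h | h⟩⟩ := h <;> rw [h] <;> simp [Even.neg_pow (by decide : Even 4)]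

lemma IsLift.norm {p : ℕ × ℝ} {q : ℕ × ℂ} (h : IsLift p q) : ‖q.2‖ = 1 := by
  obtain ⟨-, ⟨-, h | h⟩ | ⟨-, h | h⟩⟩ := h <;> rw [h] <;> simp

lemma forall_of_forall₂_isLift {l : List (ℕ × ℝ)} {l' : List (ℕ × ℂ)}
    (h : List.Forall₂ IsLift l l') {P : ℕ × ℂ → Prop}
    (hP : ∀ p ∈ l, ∀ q, IsLift p q → P q) : ∀ q ∈ l', P q := by
  induction h with
  | nil => simp
  | cons hpq _ ih =>
    simp only [List.mem_cons, forall_eq_or_imp] at hP ⊢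
    exact ⟨hP.1 _ hpq, ih hP.2⟩

lemma weight_eq_of_forall₂_isLift {l : List (ℕ × ℝ)} {l' : List (ℕ × ℂ)}
    (h : List.Forall₂ IsLift l l') : weight l' = weight l := by
  induction h with
  | nil => rfl
  | cons hpq _ ih =>
    simp only [weight, List.map_cons, List.sum_cons] at ih ⊢
    rw [ih, hpq.1]

/-- A leading exponent `1` forces the sign `-1`, hence a leading argument `±i ≠ 1`. -/
lemma Admissible.of_forall₂_isLift {l : List (ℕ × ℝ)} {l' : List (ℕ × ℂ)}
    (h : List.Forall₂ IsLift l l') (hl : Admissible l) : Admissible l' := by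
  refine ⟨forall_of_forall₂_isLift h fun p hp q hpq => hpq.1 ▸ hl.1 p hp, ?_⟩
  cases h with
  | nil => simp
  | @cons p q l l' hpq _ =>
    rintro q' hq' h1
    obtain rfl : q = q' := by simpa using hq'
    subst h1
    obtain ⟨h2, ⟨h3, -⟩ | ⟨-, h4⟩⟩ := hpq
    · exact hl.2 p (by simp) (Prod.ext h2.symm h3)
    · rcases h4 with h4 | h4 <;> simp [Complex.ext_iff] at h4

/-- Passing to the limit maps the sequences in `liftSpan l` to level four values. -/
lemma exists_tendsto_of_mem_liftSpan {l : List (ℕ × ℝ)} (hl : Admissible l) {g : ℕ → ℂ}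
    (hg : g ∈ liftSpan l) : ∃ L ∈ CMZV 4 (weight l), Tendsto g atTop (𝓝 L) := by
  induction hg using Submodule.span_induction with
  | mem f hf =>
    obtain ⟨l', hl', rfl⟩ := hf
    have hadm := Admissible.of_forall₂_isLift hl' hl
    exact ⟨cmzv l', Submodule.subset_span ⟨l', hadm, weight_eq_of_forall₂_isLift hl',
      forall_of_forall₂_isLift hl' fun _ _ _ h => h.pow_four, rfl⟩,
      tendsto_coloredSum hadm (forall_of_forall₂_isLift hl' fun _ _ _ h => h.norm)⟩
  | zero => exact ⟨0, Submodule.zero_mem _, tendsto_const_nhds⟩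
  | add f g _ _ hf hg =>
    obtain ⟨L, hL, h⟩ := hf
    obtain ⟨L', hL', h'⟩ := hg
    exact ⟨L + L', Submodule.add_mem _ hL hL', h.add h'⟩
  | smul c f _ hf =>
    obtain ⟨L, hL, h⟩ := hf
    exact ⟨c • L, Submodule.smul_mem _ c hL, h.const_smul c⟩

/-- A convergent multiple `t`-value is a power of `i` times a level four colored value. -/
lemma tendsto_signedTSum_and_mtv_eq {l : List (ℕ × ℝ)} (hl : Admissible l)
    (hs : ∀ p ∈ l, p.2 = 1 ∨ p.2 = -1) :
    Tendsto (signedTSum l) atTop (𝓝 (mtv l)) ∧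
      ∃ L ∈ CMZV 4 (weight l), (mtv l : ℂ) = signFactor l * L := by
  obtain ⟨g, hg, hgl⟩ := exists_mem_liftSpan hs
  obtain ⟨L, hL, hlim⟩ := exists_tendsto_of_mem_liftSpan hl hg
  have h1 : Tendsto (fun n => ((signedTSum l n : ℝ) : ℂ)) atTop (𝓝 (signFactor l * L)) := by
    simp only [hgl]
    exact (hlim.comp (tendsto_id.const_mul_atTop' two_pos)).const_mul _
  have h2 : Tendsto (signedTSum l) atTop (𝓝 (mtv l)) :=
    tendsto_nhds_limUnder ⟨_, (Complex.continuous_re.tendsto _).comp h1⟩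
  exact ⟨h2, L, hL, tendsto_nhds_unique ((Complex.continuous_ofReal.tendsto _).comp h2) h1⟩

lemma signFactor_eq (l : List (ℕ × ℝ)) :
    signFactor l = 1 ∨ signFactor l = -1 ∨ signFactor l = Complex.I ∨ signFactor l = -Complex.I := by
  induction l with
  | nil => exact Or.inl rfl
  | cons p l ih =>
    obtain ⟨k, ε⟩ := p
    rw [signFactor]
    split_ifs
    · rcases ih with h | h | h | h <;> simp [h]
    · simpa using ih

/-- `AMtV` lies in the `ℚ(i)`-span of the level four values. -/
lemma exists_CMZV_of_mem_AMtV {w : ℕ} {y : ℝ} (hy : y ∈ AMtV w) :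
    ∃ a ∈ CMZV 4 w, ∃ b ∈ CMZV 4 w, (y : ℂ) = a + Complex.I * b := by
  induction hy using Submodule.span_induction with
  | mem x hx =>
    obtain ⟨l, hl, rfl, hs, -, rfl⟩ := hx
    obtain ⟨-, L, hL, hLl⟩ := tendsto_signedTSum_and_mtv_eq hl hs
    rw [hLl]
    rcases signFactor_eq l with h | h | h | h <;> rw [h]
    · exact ⟨L, hL, 0, Submodule.zero_mem _, by ring⟩
    · exact ⟨-L, Submodule.neg_mem _ hL, 0, Submodule.zero_mem _, by ring⟩
    · exact ⟨0, Submodule.zero_mem _, L, hL, by ring⟩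
    · exact ⟨0, Submodule.zero_mem _, -L, Submodule.neg_mem _ hL, by ring⟩
  | zero => exact ⟨0, Submodule.zero_mem _, 0, Submodule.zero_mem _, by simp⟩
  | add x y _ _ hx hy =>
    obtain ⟨a, ha, b, hb, h⟩ := hx
    obtain ⟨a', ha', b', hb', h'⟩ := hy
    refine ⟨a + a', Submodule.add_mem _ ha ha', b + b', Submodule.add_mem _ hb hb', ?_⟩
    rw [Complex.ofReal_add, h, h']
    ring
  | smul c x _ hx =>
    obtain ⟨a, ha, b, hb, h⟩ := hx
    refine ⟨c • a, Submodule.smul_mem _ c ha, c • b, Submodule.smul_mem _ c hb, ?_⟩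
    rw [Rat.smul_def, Rat.smul_def, Rat.smul_def, Complex.ofReal_mul, h, Complex.ofReal_ratCast]
    ring

/-! ### Indices whose first entry alone is barred -/

lemma firstBarred_eq {w : ℕ} {s : Composition w} (hs : 2 ≤ s.blocks.headI) :
    firstBarred s = (s.blocks.headI, -1) ::
      s.blocks.tail.zip (List.replicate s.blocks.tail.length 1) := by
  rw [firstBarred, ← s.blocks_length]
  rcases h : s.blocks with _ | ⟨a, l⟩
  · simp [h] at hs
  · simp

lemma map_fst_firstBarred {w : ℕ} (s : Composition w) :
    (firstBarred s).map Prod.fst = s.blocks := by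
  rw [firstBarred]
  refine List.map_fst_zip ?_
  have := s.blocks_length
  rw [List.length_cons, List.length_replicate]
  omega

lemma weight_firstBarred {w : ℕ} (s : Composition w) :
    weight (firstBarred s) = w := by
  rw [weight, map_fst_firstBarred s, s.blocks_sum]

lemma admissible_firstBarred {w : ℕ} {s : Composition w} (hs : 2 ≤ s.blocks.headI) :
    Admissible (firstBarred s) := by
  refine ⟨fun p hp => ?_, ?_⟩
  · refine s.blocks_pos (i := p.1) ?_
    rw [← map_fst_firstBarred s]
    exact List.mem_map_of_mem hp
  · rw [firstBarred_eq hs]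
    rintro p hp rfl
    simp at hp
    omega

lemma sign_of_mem_firstBarred {w : ℕ} {s : Composition w} (hs : 2 ≤ s.blocks.headI) :
    ∀ p ∈ firstBarred s, p.2 = 1 ∨ p.2 = -1 := by
  rw [firstBarred_eq hs]
  intro p hp
  rcases List.mem_cons.1 hp with rfl | hp
  · exact Or.inr rfl
  · exact Or.inl (List.eq_of_mem_replicate (List.of_mem_zip (a := p.1) (b := p.2) hp).2)

lemma signFactor_firstBarred {w : ℕ} {s : Composition w} (hs : 2 ≤ s.blocks.headI) :
    signFactor (firstBarred s) = Complex.I := by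
  have h : ∀ l : List ℕ, signFactor (l.zip (List.replicate l.length 1)) = 1 := by
    intro l
    induction l with
    | nil => rfl
    | cons a l ih =>
      rw [List.length_cons, List.replicate_succ, List.zip_cons_cons, signFactor, ih,
        if_neg (by norm_num), one_mul]
  rw [firstBarred_eq hs, signFactor, h, if_pos rfl, mul_one]

lemma tendsto_signedTSum_firstBarred {w : ℕ} {s : Composition w} (hs : 2 ≤ s.blocks.headI) :
    Tendsto (signedTSum (firstBarred s)) atTop (𝓝 (mtv (firstBarred s))) :=
  (tendsto_signedTSum_and_mtv_eq (admissible_firstBarred hs) (sign_of_mem_firstBarred hs)).1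

lemma hasSum_mtv_firstBarred {w : ℕ} {s : Composition w} (hs : 2 ≤ s.blocks.headI) :
    HasSum (fun n : ℕ => (-1) ^ (n + 1) *
        (1 / (2 * (n : ℝ) + 1) ^ s.blocks.headI * tSum s.blocks.tail n))
      (mtv (firstBarred s)) := by
  have hsum : Summable fun n : ℕ => (-1) ^ (n + 1) *
      (1 / (2 * (n : ℝ) + 1) ^ s.blocks.headI * tSum s.blocks.tail n) := by
    refine Summable.of_norm_bounded (summable_harm_pow_div_sq s.blocks.tail.length) fun n => ?_
    have h0 := tSum_nonneg s.blocks.tail n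
    have h1 : tSum s.blocks.tail n ≤ harm (n + 1) ^ s.blocks.tail.length :=
      (tSum_le_harm_pow (fun a ha => s.blocks_pos (List.mem_of_mem_tail ha)) n).trans
        (pow_le_pow_left₀ (harm_nonneg n) (harm_mono n.le_succ) _)
    have h2 : 1 / (2 * (n : ℝ) + 1) ^ s.blocks.headI ≤ 1 / ((n : ℝ) + 1) ^ 2 := by
      have h3 : (0 : ℝ) ≤ n := n.cast_nonneg
      apply one_div_le_one_div_of_le (by positivity)
      calc ((n : ℝ) + 1) ^ 2 ≤ (2 * n + 1) ^ 2 := by gcongr; linarith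
        _ ≤ (2 * (n : ℝ) + 1) ^ s.blocks.headI := pow_le_pow_right₀ (by linarith) hs
    rw [norm_mul, norm_pow, norm_neg, norm_one, one_pow, one_mul,
      Real.norm_of_nonneg (by positivity)]
    exact (mul_le_mul h2 h1 h0 (by positivity)).trans_eq (one_div_mul_eq_div _ _)
  refine (hsum.hasSum_iff_tendsto_nat).2 ((tendsto_signedTSum_firstBarred hs).congr fun n => ?_)
  rw [firstBarred_eq hs, signedTSum_cons_eq_sum_range, signedTSum_zip_replicate_one]
  exact Finset.sum_congr rfl fun j _ => by ring

/-- The sum over depths of sums over compositions is a sum over all compositions with first block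
at least `2`. -/
lemma sum_compositionsOfDepth (m : ℕ) (F : ℕ → Composition (m + 2) → ℝ) :
    ∑ d ∈ Finset.Icc 1 (m + 1), ∑ s ∈ compositionsOfDepth (m + 2) d, F d s
      = ∑ s : Composition (m + 2) with 2 ≤ s.blocks.headI, F s.blocks.length s := by
  rw [← Finset.sum_fiberwise_of_maps_to (g := fun s : Composition (m + 2) => s.blocks.length)
    (t := Finset.Icc 1 (m + 1))]
  · refine Finset.sum_congr rfl fun d _ => ?_
    rw [Finset.filter_filter]
    refine Finset.sum_congr ?_ fun s hs => ?_
    · ext s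
      simp [compositionsOfDepth, and_comm]
    · rw [(Finset.mem_filter.1 hs).2.2]
  · intro s hs
    have hs := (Finset.mem_filter.1 hs).2
    have hsum := s.blocks_sum
    have hpos := fun i (hi : i ∈ s.blocks) => s.blocks_pos hi
    rw [Finset.mem_Icc]
    generalize s.blocks = b at *
    cases b with
    | nil => simp at hs
    | cons a l =>
      have h : l.length ≤ l.sum := List.length_le_sum_of_one_le l
        fun i hi => hpos i (List.mem_cons_of_mem _ hi)
      simp only [List.headI_cons, List.sum_cons, List.length_cons] at *
      omega

/-- The alternating series in terms of the multiple `t`-values of the indices `(s; -1, 1, …, 1)`. -/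
lemma hasSum_alternating_tProduct (m : ℕ) :
    HasSum (fun n : ℕ => (-1) ^ n * tProduct m n / (2 * (n : ℝ) + 1) ^ 2)
      (-(1 / 2) * ∑ d ∈ Finset.Icc 1 (m + 1), ∑ s ∈ compositionsOfDepth (m + 2) d,
        2 ^ d * mtv (firstBarred s)) := by
  rw [sum_compositionsOfDepth m fun d s => 2 ^ d * mtv (firstBarred s)]
  have h := (hasSum_sum fun (s : Composition (m + 2))
    (hs : s ∈ Finset.univ.filter fun s : Composition (m + 2) => 2 ≤ s.blocks.headI) =>
      (hasSum_mtv_firstBarred (Finset.mem_filter.1 hs).2).mul_left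
        ((2 : ℝ) ^ s.blocks.length)).mul_left (-(1 / 2))
  refine h.congr_fun fun n => ?_
  simp only [mul_left_comm ((2 : ℝ) ^ _) ((-1) ^ (n + 1))]
  rw [← Finset.mul_sum, sum_composition_tSum]
  ring

end AperyMtV

end

theorem mainTheorem1 (m : ℕ) :
    -- all series in the identities converge
    Summable (AperyMtV.aperyTerm m) ∧
    (∀ k ∈ Finset.range (m + 1), Summable (AperyMtV.tProductTerm k (m - k))) ∧
    (∀ d ∈ Finset.Icc 1 (m + 1), ∀ s ∈ AperyMtV.compositionsOfDepth (m + 2) d,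
      Filter.Tendsto (AperyMtV.signedTSum (AperyMtV.firstBarred s)) Filter.atTop
        (nhds (AperyMtV.mtv (AperyMtV.firstBarred s)))) ∧
    -- the two evaluations
    ∑' n, AperyMtV.aperyTerm m n =
      4 / Real.pi * ∑ k ∈ Finset.range (m + 1), ∑' n, AperyMtV.tProductTerm k (m - k) n ∧
    ∑' n, AperyMtV.aperyTerm m n =
      -(2 / Real.pi) * ∑ d ∈ Finset.Icc 1 (m + 1),
        ∑ s ∈ AperyMtV.compositionsOfDepth (m + 2) d,
          2 ^ d * AperyMtV.mtv (AperyMtV.firstBarred s) ∧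
    -- the series lies in `(1/π) AMtV_{m+2}`
    (∃ y ∈ AperyMtV.AMtV (m + 2), ∑' n, AperyMtV.aperyTerm m n = 1 / Real.pi * y) ∧
    -- `AMtV_{m+2} ⊂ CMZV⁴_{m+2} + i CMZV⁴_{m+2}`, the `ℚ(i)`-span of the level 4 values
    (∀ y ∈ AperyMtV.AMtV (m + 2), ∃ a ∈ AperyMtV.CMZV 4 (m + 2), ∃ b ∈ AperyMtV.CMZV 4 (m + 2),
      (y : ℂ) = a + Complex.I * b) ∧
    -- the series lies in `(i/π) CMZV⁴_{m+2}`
    (∃ z ∈ AperyMtV.CMZV 4 (m + 2),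
      ((∑' n, AperyMtV.aperyTerm m n : ℝ) : ℂ) = Complex.I / (Real.pi : ℂ) * z) := by
  have hdepth : ∀ d ∈ Finset.Icc 1 (m + 1), ∀ s ∈ AperyMtV.compositionsOfDepth (m + 2) d,
      2 ≤ s.blocks.headI := fun d _ s hs => (Finset.mem_filter.1 hs).2.2
  have hA := AperyMtV.hasSum_aperyTerm m
  have hT := (AperyMtV.hasSum_alternating_tProduct m).tsum_eq
  have hsecond : ∑' n, AperyMtV.aperyTerm m n =
      -(2 / Real.pi) * ∑ d ∈ Finset.Icc 1 (m + 1),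
        ∑ s ∈ AperyMtV.compositionsOfDepth (m + 2) d,
          2 ^ d * AperyMtV.mtv (AperyMtV.firstBarred s) := by
    rw [hA.tsum_eq, hT]
    ring
  refine ⟨hA.summable, fun k _ => AperyMtV.summable_tProductTerm k (m - k),
    fun d hd s hs => AperyMtV.tendsto_signedTSum_firstBarred (hdepth d hd s hs), ?_, hsecond,
    ?_, fun y hy => AperyMtV.exists_CMZV_of_mem_AMtV hy, ?_⟩
  · rw [hA.tsum_eq, ← Summable.tsum_finsetSum fun k _ => AperyMtV.summable_tProductTerm k (m - k)]
    simp only [AperyMtV.sum_tProductTerm]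
  · refine ⟨∑ d ∈ Finset.Icc 1 (m + 1), ∑ s ∈ AperyMtV.compositionsOfDepth (m + 2) d,
      (-2 * 2 ^ d : ℚ) • AperyMtV.mtv (AperyMtV.firstBarred s),
      Submodule.sum_mem _ fun d hd => Submodule.sum_mem _ fun s hs =>
        Submodule.smul_mem _ _ (Submodule.subset_span ?_), ?_⟩
    · have h := hdepth d hd s hs
      exact ⟨_, AperyMtV.admissible_firstBarred h, AperyMtV.weight_firstBarred s,
        AperyMtV.sign_of_mem_firstBarred h,
        ⟨(s.blocks.headI, -1), by rw [AperyMtV.firstBarred_eq h]; exact List.mem_cons_self .., rfl⟩,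
        rfl⟩
    · rw [hsecond]
      simp only [Rat.smul_def, Finset.mul_sum]
      refine Finset.sum_congr rfl fun d _ => Finset.sum_congr rfl fun s _ => ?_
      push_cast
      ring
  · have hL : ∀ s : Composition (m + 2), 2 ≤ s.blocks.headI →
        ∃ L ∈ AperyMtV.CMZV 4 (m + 2),
          (AperyMtV.mtv (AperyMtV.firstBarred s) : ℂ) = Complex.I * L := by
      intro s hs
      have h := (AperyMtV.tendsto_signedTSum_and_mtv_eq (AperyMtV.admissible_firstBarred hs)
        (AperyMtV.sign_of_mem_firstBarred hs)).2
      rwa [AperyMtV.weight_firstBarred s, AperyMtV.signFactor_firstBarred hs] at h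
    choose! L hmem hL using hL
    refine ⟨∑ d ∈ Finset.Icc 1 (m + 1), ∑ s ∈ AperyMtV.compositionsOfDepth (m + 2) d,
      (-2 * 2 ^ d : ℚ) • L s, Submodule.sum_mem _ fun d hd => Submodule.sum_mem _ fun s hs =>
        Submodule.smul_mem _ _ (hmem s (hdepth d hd s hs)), ?_⟩
    rw [hsecond]
    push_cast
    simp only [Rat.smul_def, Finset.mul_sum]
    refine Finset.sum_congr rfl fun d hd => Finset.sum_congr rfl fun s hs => ?_
    rw [hL s (hdepth d hd s hs)]
    push_cast
    ring
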